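/- All topological spaces are assumed to be Hausdorff. An ideal on a set $X$ is a family $\mathcal I\subseteq\mathcal P(X)$ with $X\notin\mathcal I$ that contains all finite subsets of $X$ and is closed under subsets and finite unions; $\mathcal I^+=\mathcal P(X)\setminus\mathcal I$. Let $\Omega,\Lambda$ be countably infinite sets. Let $\mathcal F$ be a nonempty family of infinite subsets of $\Omega$ such that $F\setminus K\in\mathcal F$ for all $F\in\mathcal F$ and all finite $K\subseteq\Omega$. A function $\rho\colon\mathcal F\to[\Lambda]^\omega$ (with values infinite subsets of $\Lambda$) is *partition regular* if - (M) $E\subseteq F$ implies $\rho(E)\subseteq\rho(F)$ for all $E,F\in\mathcal F$; - (R) if $F\in\mathcal F$ and $\rho(F)=A\cup B$, then there is $E\in\mathcal F$ with $\rho(E)\subseteq A$ or $\rho(E)\subseteq B$; - (S) for every $E\in\mathcal F$ there is $F\in\mathcal F$ with $F\subseteq E$ such that for every $a\in\rho(F)$ there is a finite $K\subseteq\Omega$ with $a\notin\rho(F\setminus K)$. Put $\mathcal I_\rho=\{A\subseteq\Lambda:\rho(F)\not\subseteq A\text{ for all }F\in\mathcal F\}$. For an ideal $\mathcal I$ on a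 countably infinite set $X$, $\rho_{\mathcal I}\colon\mathcal I^+\to[X]^\omega$ is the partition regular function $\rho_{\mathcal I}(A)=A$. - $\rho\in(S_2)$ if for every $E\in\mathcal F$ there is $F\in\mathcal F$ with $F\subseteq E$ such that for every $B\notin\mathcal I_\rho$ with $B\subseteq\rho(F)$ there is $G\in\mathcal F$ with $\rho(G)\subseteq B$ such that for every finite $K\subseteq\Omega$ there is a finite $L\subseteq\Omega$ with $\rho(G\setminus L)\subseteq\rho(F\setminus K)$. - $\rho\in P_1^-(\Lambda)$ if for every sequence $\Lambda=A_0\supseteq A_1\supseteq\dots$ with $A_n\setminus A_{n+1}\in\mathcal I_\rho$ for all $n$ there is $F\in\mathcal F$ such that for every $n$ there is a finite $K$ with $\rho(F\setminus K)\subseteq A_n$. - $\rho\in P_2^-(\Lambda)$ if for every partition $\{A_{i,j}:i,j\in\omega\}$ of $\Lambda$ (into pairwise disjoint, possibly empty sets) with all $A_{i,j}\in\mathcal I_\rho$ there is $F\in\mathcal F$ such that (a) for all $i,j$ there is a finite $K$ with $\rho(F\setminus K)\cap A_{i,j}=\emptyset$, and (b) there is $i_0$ such that for every $i>i_0$ there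 is a finite $K$ with $\rho(F\setminus K)\cap\bigcup_j A_{i,j}=\emptyset$. - For partition regular $\rho_i\colon\mathcal F_i\to[\Lambda_i]^\omega$, $\mathcal F_i\subseteq[\Omega_i]^\omega$ ($i=1,2$), $\rho_2\leq_K\rho_1$ means that there is $f\colon\Lambda_1\to\Lambda_2$ such that for every $F_1\in\mathcal F_1$ there is $F_2\in\mathcal F_2$ such that for every finite $K_1\subseteq\Omega_1$ there is a finite $K_2\subseteq\Omega_2$ with $\rho_2(F_2\setminus K_2)\subseteq f[\rho_1(F_1\setminus K_1)]$. - $\mathrm{FIN}^2$ is the ideal on $\omega^2$ of all $A$ for which there is $i_0$ such that $\{j:(i,j)\in A\}$ is finite for all $i\ge i_0$. $\mathsf{BI}$ is the ideal on $\omega^3$ of all $A$ for which there is $i_0$ such that $\{(j,k):(i,j,k)\in A\}\in\mathrm{FIN}^2$ for all $i<i_0$ and $\{(j,k):(i,j,k)\in A\}$ is finite for all $i\ge i_0$. - $\mathrm{FinBW}(\rho)$ is the class of all spaces $X$ such that for every $f\colon\Lambda\to X$ there are $F\in\mathcal F$ and $x\in X$ such that for every neighbourhood $U$ of $x$ there is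 a finite $K\subseteq\Omega$ with $f[\rho(F\setminus K)]\subseteq U$. - A space $X$ is *boring* if it is sequentially compact and there is a finite set $F\subseteq X$ such that each one-to-one convergent sequence in $X$ converges to some point of $F$. **Theorem.** Let $\rho\colon\mathcal F\to[\Lambda]^\omega$ be partition regular with $\rho\in(S_2)$. The following conditions are equivalent. 1. $\rho_{\mathsf{BI}}\leq_K\rho$ and $\rho_{\mathrm{FIN}^2}\not\leq_K\rho$. 2. $\rho\in P_1^-(\Lambda)$ and $\rho\notin P_2^-(\Lambda)$. 3. $\mathrm{FinBW}(\rho)$ coincides with the class of all boring spaces. -/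

import Mathlib

open Filter Topology Set

universe u v w v' w'

/-- An ideal on a set `X`: a proper family of subsets of `X` which is closed under finite unions
and subsets and contains all finite sets. -/
structure SetIdeal (X : Type u) where
  sets : Set (Set X)
  empty_mem : ∅ ∈ sets
  univ_notMem : univ ∉ sets
  union_mem : ∀ A B : Set X, A ∈ sets → B ∈ sets → A ∪ B ∈ sets
  subset_mem : ∀ A B : Set X, A ⊆ B → B ∈ sets → A ∈ sets
  finite_mem : ∀ A : Set X, A.Finite → A ∈ sets

/-- A partition regular function `ρ : 𝓕 → [Λ]^ω` with `𝓕 ⊆ [Ω]^ω`. The domain `𝓕` is the field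
`dom`; `toFun` is only ever evaluated at members of `dom`, and its values elsewhere are irrelevant.
(`Ω` and `Λ` are assumed to be countably infinite in the theorem.) -/
structure PartitionRegular (Ω : Type v) (Λ : Type w) where
  dom : Set (Set Ω)
  toFun : Set Ω → Set Λ
  dom_nonempty : dom.Nonempty
  infinite_of_mem_dom : ∀ F ∈ dom, F.Infinite
  diff_mem_dom : ∀ F ∈ dom, ∀ K : Finset Ω, F \ (K : Set Ω) ∈ dom
  infinite_toFun : ∀ F ∈ dom, (toFun F).Infinite
  /-- Condition (M). -/
  mono : ∀ E ∈ dom, ∀ F ∈ dom, E ⊆ F → toFun E ⊆ toFun F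
  /-- Condition (R). -/
  regular : ∀ F ∈ dom, ∀ A B : Set Λ, toFun F = A ∪ B →
    ∃ E ∈ dom, toFun E ⊆ A ∨ toFun E ⊆ B
  /-- Condition (S). -/
  sparse : ∀ E ∈ dom, ∃ F ∈ dom, F ⊆ E ∧
    ∀ a ∈ toFun F, ∃ K : Finset Ω, a ∉ toFun (F \ (K : Set Ω))

/-- The partition regular function `ρ_I : I⁺ → [X]^ω`, `ρ_I(A) = A`, given by an ideal `I`. -/
def SetIdeal.rho {X : Type u} (I : SetIdeal X) : PartitionRegular X X where
  dom := {A | A ∉ I.sets}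
  toFun := fun A => A
  dom_nonempty := ⟨univ, I.univ_notMem⟩
  infinite_of_mem_dom := fun F hF hfin => hF (I.finite_mem F hfin)
  diff_mem_dom := fun F hF K h => hF
    (I.subset_mem F ((F \ (K : Set X)) ∪ (K : Set X)) (by simp)
      (I.union_mem _ _ h (I.finite_mem _ K.finite_toSet)))
  infinite_toFun := fun F hF hfin => hF (I.finite_mem F hfin)
  mono := fun _ _ _ _ h => h
  regular := by
    intro F hF A B hAB
    by_cases hA : A ∈ I.sets
    · refine ⟨B, fun hB => hF ?_, Or.inr subset_rfl⟩
      have hAB' : F = A ∪ B := hAB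
      rw [hAB']
      exact I.union_mem _ _ hA hB
    · exact ⟨A, hA, Or.inl subset_rfl⟩
  sparse := fun E hE => ⟨E, hE, subset_rfl, fun a _ => ⟨{a}, by simp⟩⟩

/-- The family `FIN²`: `A ∈ FIN²` iff all but finitely many vertical sections of `A` are finite. -/
def fin2Sets : Set (Set (ℕ × ℕ)) :=
  {A | ∃ i₀ : ℕ, ∀ i ≥ i₀, {j : ℕ | (i, j) ∈ A}.Finite}

/-- The family `BI` of subsets of `ω³`. -/
def biSets : Set (Set (ℕ × ℕ × ℕ)) :=
  {A | ∃ i₀ : ℕ,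
    (∀ i < i₀, {p : ℕ × ℕ | (i, p.1, p.2) ∈ A} ∈ fin2Sets) ∧
    (∀ i ≥ i₀, {p : ℕ × ℕ | (i, p.1, p.2) ∈ A}.Finite)}

theorem fin2Sets_finite (A : Set (ℕ × ℕ)) (hA : A.Finite) : A ∈ fin2Sets :=
  ⟨0, fun _ _ => hA.preimage (fun _ _ _ _ h => (Prod.mk.inj h).2)⟩

theorem fin2Sets_union (A B : Set (ℕ × ℕ)) (hA : A ∈ fin2Sets) (hB : B ∈ fin2Sets) :
    A ∪ B ∈ fin2Sets := by
  obtain ⟨a, ha⟩ := hA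
  obtain ⟨b, hb⟩ := hB
  exact ⟨max a b, fun i hi =>
    (ha i (le_trans (le_max_left _ _) hi)).union (hb i (le_trans (le_max_right _ _) hi))⟩

theorem fin2Sets_subset (A B : Set (ℕ × ℕ)) (hAB : A ⊆ B) (hB : B ∈ fin2Sets) :
    A ∈ fin2Sets := by
  obtain ⟨b, hb⟩ := hB
  exact ⟨b, fun i hi => (hb i hi).subset fun _ hj => hAB hj⟩

/-- The ideal `FIN² = FIN ⊗ FIN` on `ω²`. -/
def idealFIN2 : SetIdeal (ℕ × ℕ) where
  sets := fin2Sets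
  empty_mem := fin2Sets_finite ∅ finite_empty
  univ_notMem := by
    rintro ⟨i₀, h⟩
    have := h i₀ le_rfl
    simp only [mem_univ, setOf_true] at this
    exact infinite_univ this
  union_mem := fin2Sets_union
  subset_mem := fin2Sets_subset
  finite_mem := fin2Sets_finite

/-- The ideal `BI` on `ω³`. -/
def idealBI : SetIdeal (ℕ × ℕ × ℕ) where
  sets := biSets
  empty_mem := ⟨0, fun _ h => absurd h (Nat.not_lt_zero _), fun _ _ => by simp⟩
  univ_notMem := by
    rintro ⟨i₀, -, h⟩
    have := h i₀ le_rfl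
    simp only [mem_univ, setOf_true] at this
    exact infinite_univ this
  union_mem := by
    rintro A B ⟨a, ha, ha'⟩ ⟨b, hb, hb'⟩
    refine ⟨max a b, fun i _ => ?_, fun i hi => ?_⟩
    · refine fin2Sets_union _ _ ?_ ?_
      · by_cases h : i < a
        · exact ha i h
        · exact fin2Sets_finite _ (ha' i (not_lt.mp h))
      · by_cases h : i < b
        · exact hb i h
        · exact fin2Sets_finite _ (hb' i (not_lt.mp h))
    · exact (ha' i (le_trans (le_max_left _ _) hi)).union
        (hb' i (le_trans (le_max_right _ _) hi))
  subset_mem := by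
    rintro A B hAB ⟨b, hb, hb'⟩
    exact ⟨b, fun i hi => fin2Sets_subset _ _ (fun _ hp => hAB hp) (hb i hi),
      fun i hi => (hb' i hi).subset fun _ hp => hAB hp⟩
  finite_mem := fun A hA => ⟨0, fun _ h => absurd h (Nat.not_lt_zero _), fun _ _ =>
    hA.preimage (fun _ _ _ _ h => (Prod.mk.inj h).2)⟩

namespace PartitionRegular

variable {Ω : Type v} {Λ : Type w} {Ω' : Type v'} {Λ' : Type w'}

/-- The ideal `I_ρ = {A ⊆ Λ : ρ(F) ⊄ A for all F ∈ 𝓕}`. -/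
def ideal (ρ : PartitionRegular Ω Λ) : Set (Set Λ) :=
  {A | ∀ F ∈ ρ.dom, ¬ ρ.toFun F ⊆ A}

/-- The Katětov order: `KatetovLE ρ₂ ρ₁` means `ρ₂ ≤_K ρ₁`. -/
def KatetovLE (ρ₂ : PartitionRegular Ω' Λ') (ρ₁ : PartitionRegular Ω Λ) : Prop :=
  ∃ f : Λ → Λ', ∀ F₁ ∈ ρ₁.dom, ∃ F₂ ∈ ρ₂.dom, ∀ K₁ : Finset Ω, ∃ K₂ : Finset Ω',
    ρ₂.toFun (F₂ \ (K₂ : Set Ω')) ⊆ f '' ρ₁.toFun (F₁ \ (K₁ : Set Ω))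

/-- The property `(S₂)`. -/
def S2 (ρ : PartitionRegular Ω Λ) : Prop :=
  ∀ E ∈ ρ.dom, ∃ F ∈ ρ.dom, F ⊆ E ∧
    ∀ B : Set Λ, B ∉ ρ.ideal → B ⊆ ρ.toFun F →
      ∃ G ∈ ρ.dom, ρ.toFun G ⊆ B ∧
        ∀ K : Finset Ω, ∃ L : Finset Ω,
          ρ.toFun (G \ (L : Set Ω)) ⊆ ρ.toFun (F \ (K : Set Ω))

/-- The property `P₁⁻(Λ)`, i.e. `P⁻(Λ)`. -/
def P1Minus (ρ : PartitionRegular Ω Λ) : Prop :=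
  ∀ A : ℕ → Set Λ, A 0 = univ → (∀ n, A (n + 1) ⊆ A n) →
    (∀ n, A n \ A (n + 1) ∈ ρ.ideal) →
    ∃ F ∈ ρ.dom, ∀ n, ∃ K : Finset Ω, ρ.toFun (F \ (K : Set Ω)) ⊆ A n

/-- The property `P₂⁻(Λ)`; the members of a partition indexed by `ω × ω` may be empty. -/
def P2Minus (ρ : PartitionRegular Ω Λ) : Prop :=
  ∀ A : ℕ → ℕ → Set Λ,
    (∀ i j i' j', (i, j) ≠ (i', j') → Disjoint (A i j) (A i' j')) →
    (⋃ i, ⋃ j, A i j) = univ →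
    (∀ i j, A i j ∈ ρ.ideal) →
    ∃ F ∈ ρ.dom,
      (∀ i j, ∃ K : Finset Ω, ρ.toFun (F \ (K : Set Ω)) ∩ A i j = ∅) ∧
      (∃ i₀, ∀ i > i₀, ∃ K : Finset Ω, ρ.toFun (F \ (K : Set Ω)) ∩ ⋃ j, A i j = ∅)

/-- `f ↾ ρ(F)` `ρ`-converges to `x`. -/
def ConvergesTo {X : Type u} [TopologicalSpace X] (ρ : PartitionRegular Ω Λ) (f : Λ → X)
    (F : Set Ω) (x : X) : Prop :=
  ∀ U ∈ 𝓝 x, ∃ K : Finset Ω, f '' ρ.toFun (F \ (K : Set Ω)) ⊆ U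

/-- The space `X` belongs to the class `FinBW(ρ)`. -/
def FinBW (ρ : PartitionRegular Ω Λ) (X : Type u) [TopologicalSpace X] : Prop :=
  ∀ f : Λ → X, ∃ F ∈ ρ.dom, ∃ x : X, ρ.ConvergesTo f F x

end PartitionRegular

/-- A sequentially compact space is boring if there is a finite set `F` such that each one-to-one
convergent sequence in the space converges to some point of `F`. -/
def BoringSpace (X : Type u) [TopologicalSpace X] : Prop :=
  SeqCompactSpace X ∧ ∃ F : Set X, F.Finite ∧
    ∀ s : ℕ → X, Function.Injective s → (∃ x, Tendsto s atTop (𝓝 x)) →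
      ∃ x ∈ F, Tendsto s atTop (𝓝 x)

/-! Say that `F` eventually avoids `S` if `ρ(F \ K)` is disjoint from `S` for some finite `K`. For
fixed `F` such `S` are closed under subsets and finite unions, and P₁⁻, P₂⁻ and `ρ`-convergence are
all statements about avoidance. Condition (S₂) supplies sets `F` below which every positive `B ⊆
ρ(F)` contains some `ρ(G)` with `G` avoiding whatever `F` avoids. So a null set can be discarded, or
a positive piece selected, without losing avoidance.

(1) ⇔ (2): P₁⁻ and P₂⁻ are the failures of the two Katětov reductions (`S2.katetovLE_FIN2`,
`S2.katetovLE_BI` and their converses). If a labelling `g` of `Λ` refutes the property, a good `F`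
must fail to avoid infinitely many fibres (or planes, or lines in one plane), since finitely many
bad null fibres could be discarded. A diagonal choice (`exists_pseudoIntersection`) then produces
the positive set required by the reduction.

(2) ⇒ (3): a boring space is, up to a finite set, a finite union of sets each converging to a point,
so P₁⁻ suffices for FinBW. A space with infinitely many limits of one-to-one sequences contains a
copy of `ω²` with distinct row limits, and FinBW for it would yield P₂⁻.

(3) ⇒ (2): two test spaces decide. The convergent sequence `ℕ∞` is boring, and its FinBW gives P₁⁻;
the one-point compactification of `ℕ × ℕ∞` is not boring, but P₂⁻ would put it in FinBW. -/

namespace PartitionRegular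

/-! ### The ideal of `ρ`, eventual avoidance and diagonal sets. -/

section Basic

variable {Ω : Type v} {Λ : Type w} (ρ : PartitionRegular Ω Λ)

theorem ideal_mono {A B : Set Λ} (h : A ⊆ B) (hB : B ∈ ρ.ideal) : A ∈ ρ.ideal :=
  fun F hF hFA => hB F hF (hFA.trans h)

/-- This is what condition (R) is for: split `ρ(F)` along `A` and `B`. -/
theorem union_mem_ideal {A B : Set Λ} (hA : A ∈ ρ.ideal) (hB : B ∈ ρ.ideal) :
    A ∪ B ∈ ρ.ideal := by
  intro F hF hFAB
  obtain ⟨E, hE, h⟩ := ρ.regular F hF (ρ.toFun F ∩ A) (ρ.toFun F ∩ B) (by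
    rw [← inter_union_distrib_left, inter_eq_left.mpr hFAB])
  rcases h with h | h
  · exact hA E hE (h.trans inter_subset_right)
  · exact hB E hE (h.trans inter_subset_right)

theorem empty_mem_ideal : ∅ ∈ ρ.ideal := fun F hF h =>
  ρ.infinite_toFun F hF (finite_empty.subset h)

theorem toFun_notMem_ideal {F : Set Ω} (hF : F ∈ ρ.dom) : ρ.toFun F ∉ ρ.ideal :=
  fun h => h F hF subset_rfl

theorem biUnion_mem_ideal {ι : Type*} {T : Set ι} (hT : T.Finite) {S : ι → Set Λ}
    (h : ∀ i ∈ T, S i ∈ ρ.ideal) : ⋃ i ∈ T, S i ∈ ρ.ideal := by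
  induction T, hT using Set.Finite.induction_on with
  | empty => simpa using ρ.empty_mem_ideal
  | @insert a s _ _ ih =>
    rw [biUnion_insert]
    exact ρ.union_mem_ideal (h a (mem_insert _ _)) (ih fun i hi => h i (mem_insert_of_mem _ hi))

theorem diff_notMem_ideal {A B : Set Λ} (hA : A ∉ ρ.ideal) (hB : B ∈ ρ.ideal) :
    A \ B ∉ ρ.ideal := fun h =>
  hA (ρ.ideal_mono (by simp) (ρ.union_mem_ideal h hB))

theorem toFun_diff_subset {F : Set Ω} (hF : F ∈ ρ.dom) {K L : Finset Ω} (h : K ⊆ L) :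
    ρ.toFun (F \ L) ⊆ ρ.toFun (F \ K) :=
  ρ.mono _ (ρ.diff_mem_dom F hF L) _ (ρ.diff_mem_dom F hF K)
    (sdiff_subset_sdiff_right (by exact_mod_cast h))

theorem toFun_diff_subset_self {F : Set Ω} (hF : F ∈ ρ.dom) (K : Finset Ω) :
    ρ.toFun (F \ K) ⊆ ρ.toFun F :=
  ρ.mono _ (ρ.diff_mem_dom F hF K) _ hF sdiff_subset

/-- The sets `ρ(F \ K)` are eventually disjoint from `S`. -/
def EvAvoids (F : Set Ω) (S : Set Λ) : Prop :=
  ∃ K : Finset Ω, Disjoint (ρ.toFun (F \ (K : Set Ω))) S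

variable {ρ}

theorem EvAvoids.mono {F : Set Ω} {S T : Set Λ} (h : ρ.EvAvoids F T) (hST : S ⊆ T) :
    ρ.EvAvoids F S :=
  h.imp fun _ hK => hK.mono_right hST

theorem EvAvoids.of_subset {E F : Set Ω} (hE : E ∈ ρ.dom) (hF : F ∈ ρ.dom) (hEF : E ⊆ F)
    {S : Set Λ} (h : ρ.EvAvoids F S) : ρ.EvAvoids E S :=
  h.imp fun K hK => hK.mono_left (ρ.mono _ (ρ.diff_mem_dom E hE K) _ (ρ.diff_mem_dom F hF K)
    (sdiff_subset_sdiff_left hEF))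

theorem EvAvoids.of_disjoint {F : Set Ω} (hF : F ∈ ρ.dom) {S : Set Λ}
    (h : Disjoint (ρ.toFun F) S) : ρ.EvAvoids F S :=
  ⟨∅, h.mono_left (ρ.toFun_diff_subset_self hF ∅)⟩

theorem EvAvoids.union {F : Set Ω} (hF : F ∈ ρ.dom) {S T : Set Λ} (hS : ρ.EvAvoids F S)
    (hT : ρ.EvAvoids F T) : ρ.EvAvoids F (S ∪ T) := by
  classical
  obtain ⟨K, hK⟩ := hS
  obtain ⟨L, hL⟩ := hT
  exact ⟨K ∪ L, disjoint_union_right.mpr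
    ⟨hK.mono_left (ρ.toFun_diff_subset hF Finset.subset_union_left),
      hL.mono_left (ρ.toFun_diff_subset hF Finset.subset_union_right)⟩⟩

theorem EvAvoids.biUnion {ι : Type*} {F : Set Ω} (hF : F ∈ ρ.dom) {T : Set ι} (hT : T.Finite)
    {S : ι → Set Λ} (h : ∀ i ∈ T, ρ.EvAvoids F (S i)) : ρ.EvAvoids F (⋃ i ∈ T, S i) := by
  induction T, hT using Set.Finite.induction_on with
  | empty => exact .of_disjoint hF (by simp)
  | @insert a s _ _ ih =>
    rw [biUnion_insert]
    exact (h a (mem_insert _ _)).union hF (ih fun i hi => h i (mem_insert_of_mem _ hi))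

theorem convergesTo_iff {X : Type u} [TopologicalSpace X] {f : Λ → X} {F : Set Ω} {x : X} :
    ρ.ConvergesTo f F x ↔ ∀ U ∈ 𝓝 x, ρ.EvAvoids F (f ⁻¹' Uᶜ) := by
  simp only [ConvergesTo, EvAvoids, image_subset_iff, preimage_compl, disjoint_compl_right_iff_subset]

variable (ρ) in
/-- The property that (S) provides. -/
def IsSparse (F : Set Ω) : Prop :=
  ∀ a ∈ ρ.toFun F, ρ.EvAvoids F {a}

variable (ρ) in
/-- Every positive subset of `ρ(F)` contains some `ρ(G)` that is eventually below `F`. -/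
def IsRefinable (F : Set Ω) : Prop :=
  ∀ B : Set Λ, B ∉ ρ.ideal → B ⊆ ρ.toFun F →
    ∃ G ∈ ρ.dom, ρ.toFun G ⊆ B ∧ ∀ S, ρ.EvAvoids F S → ρ.EvAvoids G S

theorem exists_isSparse {E : Set Ω} (hE : E ∈ ρ.dom) :
    ∃ F ∈ ρ.dom, F ⊆ E ∧ ρ.IsSparse F := by
  obtain ⟨F, hF, hFE, h⟩ := ρ.sparse E hE
  exact ⟨F, hF, hFE, fun a ha => (h a ha).imp fun K hK => disjoint_singleton_right.mpr hK⟩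

theorem S2.exists_isRefinable (hρ : ρ.S2) {E : Set Ω} (hE : E ∈ ρ.dom) :
    ∃ F ∈ ρ.dom, F ⊆ E ∧ ρ.IsSparse F ∧ ρ.IsRefinable F := by
  obtain ⟨E', hE', hEE', hs⟩ := exists_isSparse hE
  obtain ⟨F, hF, hFE, h⟩ := hρ E' hE'
  refine ⟨F, hF, hFE.trans hEE', fun a ha =>
    (hs a (ρ.mono _ hF _ hE' hFE ha)).of_subset hF hE' hFE, fun B hB hBF => ?_⟩
  obtain ⟨G, hG, hGB, hGF⟩ := h B hB hBF
  exact ⟨G, hG, hGB, fun S ⟨K, hK⟩ => (hGF K).imp fun L hL => hK.mono_left hL⟩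

/-- Diagonalisation: enumerate a cofinal sequence of finite sets `K m` and pick `a i j` in `C i ∩
ρ(F \ K (h i + j))`. Only finitely many pairs have `h i + j < m`, so `D` is almost contained in each
`ρ(F \ K)`. Sparseness makes each row of choices infinite: a finite set of points of `ρ(F)` would be
avoided by `F`. -/
theorem exists_pseudoIntersection [Countable Ω] {ι : Type*} [Countable ι] {F : Set Ω}
    (hF : F ∈ ρ.dom) (hs : ρ.IsSparse F) {C : ι → Set Λ} (hC : ∀ i, ¬ ρ.EvAvoids F (C i)) :
    ∃ D : Set Λ, (∀ i, (D ∩ C i).Infinite) ∧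
      ∀ K : Finset Ω, (D \ ρ.toFun (F \ (K : Set Ω))).Finite := by
  classical
  obtain ⟨e, he⟩ := exists_injective_nat Ω
  obtain ⟨h, hh⟩ := exists_injective_nat ι
  let K : ℕ → Finset Ω := fun m => (Finset.range m).preimage e he.injOn
  have hK : ∀ L : Finset Ω, ∃ m, ∀ n ≥ m, L ⊆ K n := by
    intro L
    refine ⟨L.sup e + 1, fun n hn x hx => ?_⟩
    have : e x ≤ L.sup e := Finset.le_sup hx
    simp only [K, Finset.mem_preimage, Finset.mem_range]
    omega
  have hne : ∀ i j, ∃ a, a ∈ ρ.toFun (F \ (K (h i + j) : Set Ω)) ∧ a ∈ C i := fun i j =>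
    not_disjoint_iff.mp fun hd => hC i ⟨_, hd⟩
  choose a ha haC using hne
  refine ⟨range fun p : ι × ℕ => a p.1 p.2, fun i hfin => ?_, fun L => ?_⟩
  · have hfin' : (range (a i)).Finite := hfin.subset (by
      rintro _ ⟨j, rfl⟩
      exact ⟨⟨(i, j), rfl⟩, haC i j⟩)
    have hav : ρ.EvAvoids F (⋃ b ∈ range (a i), {b}) := EvAvoids.biUnion hF hfin' (by
      rintro _ ⟨j, rfl⟩
      exact hs _ (ρ.toFun_diff_subset_self hF _ (ha i j)))
    rw [biUnion_of_singleton] at hav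
    obtain ⟨L, hL⟩ := hav
    obtain ⟨m, hm⟩ := hK L
    exact disjoint_left.mp hL (ρ.toFun_diff_subset hF (hm _ (Nat.le_add_left m (h i))) (ha i m))
      ⟨m, rfl⟩
  · obtain ⟨m, hm⟩ := hK L
    have hfin : {p : ι × ℕ | h p.1 + p.2 < m}.Finite := by
      refine Set.Finite.of_finite_image (f := fun p : ι × ℕ => (h p.1, p.2))
        (((finite_Iio m).prod (finite_Iio m)).subset ?_) ?_
      · rintro _ ⟨p, hp, rfl⟩
        simp only [mem_ofPred_eq] at hp
        simp only [mem_prod, mem_Iio]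
        omega
      · rintro p - q - hpq
        exact Prod.ext (hh (Prod.mk.inj hpq).1) (Prod.mk.inj hpq).2
    refine (hfin.image fun p : ι × ℕ => a p.1 p.2).subset ?_
    rintro _ ⟨⟨p, rfl⟩, hp⟩
    refine ⟨p, ?_, rfl⟩
    by_contra hlt
    exact hp (ρ.toFun_diff_subset hF (hm _ (not_lt.mp hlt)) (ha _ _))

/-- The `I`-positive set is `f '' D`. By injectivity, removing the finite image of `D \ ρ(F \ K)`
leaves only images of points of `ρ(F \ K)`. -/
theorem katetovLE_rho_of_injective {X : Type*} {I : SetIdeal X} (hρ : ρ.S2) {f : Λ → X}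
    (hf : f.Injective)
    (h : ∀ F ∈ ρ.dom, ρ.IsSparse F → ρ.IsRefinable F →
      ∃ D : Set Λ, f '' D ∉ I.sets ∧ ∀ K : Finset Ω, (D \ ρ.toFun (F \ (K : Set Ω))).Finite) :
    KatetovLE I.rho ρ := by
  refine ⟨f, fun E hE => ?_⟩
  obtain ⟨F, hF, hFE, hs, hr⟩ := hρ.exists_isRefinable hE
  obtain ⟨D, hD, hDK⟩ := h F hF hs hr
  refine ⟨f '' D, hD, fun K => ⟨((hDK K).image f).toFinset, ?_⟩⟩
  have hsub := ρ.mono _ (ρ.diff_mem_dom F hF K) _ (ρ.diff_mem_dom E hE K)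
    (sdiff_subset_sdiff_left hFE)
  refine Subset.trans ?_ (image_mono hsub)
  show f '' D \ _ ⊆ _
  rw [Finite.coe_toFinset, ← image_sdiff hf, sdiff_sdiff_right_self]
  exact image_mono inter_subset_right

/-- Maps witnessing `ρ_I ≤_K ρ` for an ideal `I`. -/
theorem exists_of_katetovLE_rho {X : Type*} {I : SetIdeal X} (h : KatetovLE I.rho ρ) :
    ∃ f : Λ → X, (∀ A ∈ I.sets, f ⁻¹' A ∈ ρ.ideal) ∧
      ∀ F ∈ ρ.dom, ∃ D ∉ I.sets, ∀ S, ρ.EvAvoids F (f ⁻¹' S) → (D ∩ S).Finite := by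
  obtain ⟨f, hf⟩ := h
  refine ⟨f, fun A hA F hF hFA => ?_, fun F hF => ?_⟩
  · obtain ⟨D, hD, h⟩ := hf F hF
    obtain ⟨K, hK⟩ := h ∅
    have hDA : D \ (K : Set X) ⊆ A := hK.trans
      ((image_mono ((ρ.toFun_diff_subset_self hF ∅).trans hFA)).trans (image_preimage_subset f A))
    exact hD (I.subset_mem _ ((D \ (K : Set X)) ∪ K) (by simp)
      (I.union_mem _ _ (I.subset_mem _ _ hDA hA) (I.finite_mem _ K.finite_toSet)))
  · obtain ⟨D, hD, h⟩ := hf F hF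
    refine ⟨D, hD, fun S ⟨K, hK⟩ => ?_⟩
    obtain ⟨L, hL⟩ := h K
    refine L.finite_toSet.subset fun x ⟨hxD, hxS⟩ => ?_
    by_contra hxL
    obtain ⟨a, ha, rfl⟩ := hL ⟨hxD, hxL⟩
    exact disjoint_left.mp hK ha hxS

/-! ### The properties P₁⁻ and P₂⁻ in terms of labellings of `Λ`. -/

theorem p1Minus_iff : ρ.P1Minus ↔ ∀ g : Λ → ℕ, (∀ n, g ⁻¹' {n} ∈ ρ.ideal) →
    ∃ F ∈ ρ.dom, ∀ n, ρ.EvAvoids F (g ⁻¹' {n}) := by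
  classical
  constructor
  · intro h g hg
    obtain ⟨F, hF, hK⟩ := h (fun n => {a | n ≤ g a}) (by simp)
      (fun n a ha => (Nat.le_succ n).trans ha) (fun n => ρ.ideal_mono (fun a ha => by
        simp only [Set.mem_sdiff, mem_ofPred_eq] at ha
        simp only [mem_preimage, mem_singleton_iff]
        omega) (hg n))
    refine ⟨F, hF, fun n => (hK (n + 1)).imp fun K hK => disjoint_left.mpr fun a ha han => ?_⟩
    have h1 : n + 1 ≤ g a := hK ha
    have h2 : g a = n := han
    omega
  · intro h A h0 hA hI
    by_cases hω : (⋂ n, A n) ∈ ρ.ideal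
    -- The label of `a` is the last `n` with `a ∈ A n`; points of the intersection, a null set in
    -- this case, get label 0.
    · have hex : ∀ a, ∃ n, a ∈ (⋂ n, A n) ∨ a ∉ A (n + 1) := fun a => by
        by_cases ha : a ∈ ⋂ n, A n
        · exact ⟨0, .inl ha⟩
        · obtain ⟨n, hn⟩ := not_forall.mp (mt mem_iInter.mpr ha)
          exact ⟨n, .inr fun h => hn (hA n h)⟩
      obtain ⟨F, hF, hK⟩ := h (fun a => Nat.find (hex a)) (fun n => by
        refine ρ.ideal_mono ?_ (ρ.union_mem_ideal hω (hI n))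
        rintro a rfl
        refine (Nat.find_spec (hex a)).imp_right fun h => ⟨?_, h⟩
        rcases Nat.eq_zero_or_pos (Nat.find (hex a)) with h0' | h0'
        · show a ∈ A (Nat.find (hex a))
          rw [h0', h0]; trivial
        · have := Nat.find_min (hex a) (Nat.sub_lt h0' one_pos)
          rw [show Nat.find (hex a) - 1 + 1 = Nat.find (hex a) by omega] at this
          exact not_not.mp fun h => this (.inr h))
      refine ⟨F, hF, fun n => ?_⟩
      have := EvAvoids.biUnion hF (finite_Iio n) fun i _ => hK i
      refine this.imp fun K hK a ha => ?_
      by_contra han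
      have hn : n ≠ 0 := by rintro rfl; exact han (h0 ▸ mem_univ a)
      refine disjoint_left.mp hK ha (mem_biUnion (x := Nat.find (hex a)) ?_ rfl)
      refine (Nat.find_min' (hex a) (m := n - 1) (.inr ?_)).trans_lt (Nat.sub_lt (by omega) one_pos)
      rwa [Nat.sub_add_cancel (by omega)]
    -- A positive intersection contains some `ρ(F)`, which works with no removal.
    · simp only [ideal, mem_ofPred_eq, not_forall, not_not] at hω
      obtain ⟨F, hF, hFA⟩ := hω
      exact ⟨F, hF, fun n => ⟨∅, (ρ.toFun_diff_subset_self hF ∅).trans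
        (hFA.trans (iInter_subset _ n))⟩⟩

theorem p2Minus_iff : ρ.P2Minus ↔ ∀ g : Λ → ℕ × ℕ, (∀ p, g ⁻¹' {p} ∈ ρ.ideal) →
    ∃ F ∈ ρ.dom, (∀ p, ρ.EvAvoids F (g ⁻¹' {p})) ∧
      ∃ i₀, ∀ i > i₀, ρ.EvAvoids F {a | (g a).1 = i} := by
  simp only [EvAvoids, disjoint_iff_inter_eq_empty]
  constructor
  · intro h g hg
    have hU : ∀ i, ⋃ j, g ⁻¹' {(i, j)} = {a | (g a).1 = i} := fun i => by
      ext a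
      simp [Prod.ext_iff]
    obtain ⟨F, hF, h1, h2⟩ := h (fun i j => g ⁻¹' {(i, j)})
      (fun i j i' j' hne => Disjoint.preimage g (by simpa using hne))
      (eq_univ_of_forall fun a => mem_iUnion₂.mpr ⟨(g a).1, (g a).2, rfl⟩)
      (fun i j => hg (i, j))
    simp only [hU] at h2
    exact ⟨F, hF, fun p => h1 p.1 p.2, h2⟩
  · intro h A hd hu hA
    have hex : ∀ a, ∃ p : ℕ × ℕ, a ∈ A p.1 p.2 := fun a => by
      obtain ⟨i, j, h⟩ := mem_iUnion₂.mp (hu ▸ mem_univ a)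
      exact ⟨(i, j), h⟩
    choose g hg using hex
    have hgA : ∀ p : ℕ × ℕ, g ⁻¹' {p} = A p.1 p.2 := fun p => by
      ext a
      refine ⟨fun h => (show g a = p from h) ▸ hg a, fun h => ?_⟩
      by_contra hne
      exact disjoint_left.mp (hd _ _ _ _ hne) (hg a) h
    have hU : ∀ i, {a | (g a).1 = i} = ⋃ j, A i j := fun i => by
      ext a
      simp only [mem_ofPred_eq, mem_iUnion]
      refine ⟨fun h => ⟨(g a).2, h ▸ hg a⟩, fun ⟨j, hj⟩ => ?_⟩
      have : a ∈ g ⁻¹' {(i, j)} := (hgA (i, j)).symm ▸ hj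
      exact congrArg Prod.fst (show g a = (i, j) from this)
    obtain ⟨F, hF, h1, h2⟩ := h g fun p => (hgA p).symm ▸ hA _ _
    simp only [hU] at h2
    exact ⟨F, hF, fun i j => by simpa only [hgA] using h1 (i, j), h2⟩

/-! ### P₁⁻ and P₂⁻ against Katětov reductions of `FIN²` and `BI`. -/

/-- Label by the column of `f a`. If `F` avoids every column, the associated positive `D` meets
every column in a finite set, so it lies in `FIN²`. -/
theorem not_p1Minus_of_katetovLE (h : KatetovLE idealFIN2.rho ρ) : ¬ ρ.P1Minus := by
  rw [p1Minus_iff]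
  obtain ⟨f, hf, hD⟩ := exists_of_katetovLE_rho h
  intro hP
  obtain ⟨F, hF, hav⟩ := hP (fun a => (f a).1) fun n =>
    hf {p | p.1 = n} ⟨n + 1, fun i hi => by
      have : i ≠ n := by omega
      simp [this]⟩
  obtain ⟨D, hDI, hDS⟩ := hD F hF
  refine hDI ⟨0, fun i _ => ((hDS {p | p.1 = i} (hav i)).image Prod.snd).subset fun j hj =>
    ⟨(i, j), ⟨hj, rfl⟩, rfl⟩⟩

/-- Label by the first two coordinates of `f a`. Avoiding all lines, and all planes beyond `i₀`,
forces the associated `D` into `BI` with threshold `i₀ + 1`. -/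
theorem not_p2Minus_of_katetovLE (h : KatetovLE idealBI.rho ρ) : ¬ ρ.P2Minus := by
  rw [p2Minus_iff]
  obtain ⟨f, hf, hD⟩ := exists_of_katetovLE_rho h
  intro hP
  obtain ⟨F, hF, hav, i₀, hi₀⟩ := hP (fun a => ((f a).1, (f a).2.1)) fun p =>
    hf {q | (q.1, q.2.1) = p} ⟨p.1 + 1, fun i _ => ⟨p.2 + 1, fun j hj => by
      have : j ≠ p.2 := by omega
      simp [Prod.ext_iff, this]⟩, fun i hi => by
      have : i ≠ p.1 := by omega
      simp [Prod.ext_iff, this]⟩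
  obtain ⟨D, hDI, hDS⟩ := hD F hF
  refine hDI ⟨i₀ + 1, fun i _ => ⟨0, fun j _ => ?_⟩, fun i hi => ?_⟩
  · exact ((hDS {q | (q.1, q.2.1) = (i, j)} (hav (i, j))).image fun q => q.2.2).subset fun k hk =>
      ⟨(i, j, k), ⟨hk, rfl⟩, rfl⟩
  · exact ((hDS {q | q.1 = i} (hi₀ i hi)).image fun q => q.2).subset fun p hp =>
      ⟨(i, p.1, p.2), ⟨hp, rfl⟩, rfl⟩

theorem S2.katetovLE_FIN2 [Countable Ω] [Countable Λ] (hρ : ρ.S2) (h : ¬ ρ.P1Minus) :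
    KatetovLE idealFIN2.rho ρ := by
  rw [p1Minus_iff] at h
  push Not at h
  obtain ⟨g, hg, hF⟩ := h
  obtain ⟨e, he⟩ := exists_injective_nat Λ
  -- The coordinate `e a` only makes the map injective.
  refine katetovLE_rho_of_injective (f := fun a => (g a, e a)) hρ
    (fun a b hab => he (Prod.mk.inj hab).2) fun F hFd hs hr => ?_
  -- Otherwise discard the finitely many fibres not avoided: the resulting `G` avoids every fibre,
  -- against the choice of `g`.
  have hT : {n | ¬ ρ.EvAvoids F (g ⁻¹' {n})}.Infinite := by
    intro hT
    obtain ⟨G, hG, hGB, hGF⟩ := hr _ (ρ.diff_notMem_ideal (ρ.toFun_notMem_ideal hFd)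
      (ρ.biUnion_mem_ideal hT fun n _ => hg n)) sdiff_subset
    obtain ⟨n, hn⟩ := hF G hG
    by_cases hnF : ρ.EvAvoids F (g ⁻¹' {n})
    · exact hn (hGF _ hnF)
    · exact hn (.of_disjoint hG (disjoint_left.mpr fun a ha han =>
        (hGB ha).2 (mem_biUnion (x := n) hnF han)))
  obtain ⟨D, hD, hDK⟩ := exists_pseudoIntersection hFd hs
    (C := fun n : {n | ¬ ρ.EvAvoids F (g ⁻¹' {n})} => g ⁻¹' {n.1}) fun n => n.2
  refine ⟨D, ?_, hDK⟩
  rintro ⟨i₀, hi₀⟩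
  obtain ⟨i, hi, hii⟩ := hT.exists_gt i₀
  refine (hD ⟨i, hi⟩).image he.injOn ((hi₀ i hii.le).subset ?_)
  rintro _ ⟨a, ⟨haD, rfl⟩, rfl⟩
  exact ⟨a, haD, rfl⟩

theorem S2.katetovLE_BI [Countable Ω] [Countable Λ] (hρ : ρ.S2) (h : ¬ ρ.P2Minus) :
    KatetovLE idealBI.rho ρ := by
  rw [p2Minus_iff] at h
  push Not at h
  obtain ⟨g, hg, hF⟩ := h
  obtain ⟨e, he⟩ := exists_injective_nat Λ
  refine katetovLE_rho_of_injective (f := fun a => ((g a).1, (g a).2, e a)) hρ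
    (fun a b hab => he (Prod.mk.inj (Prod.mk.inj hab).2).2) fun F hFd hs hr => ?_
  -- A set is `BI`-positive as soon as infinitely many of its planes are infinite or one of its
  -- planes is outside `FIN²`. These are the first two cases; the third contradicts the choice of
  -- `g`.
  by_cases hR : {i | ¬ ρ.EvAvoids F {a | (g a).1 = i}}.Infinite
  · obtain ⟨D, hD, hDK⟩ := exists_pseudoIntersection hFd hs
      (C := fun i : {i | ¬ ρ.EvAvoids F {a | (g a).1 = i}} => {a | (g a).1 = i.1}) fun i => i.2
    refine ⟨D, ?_, hDK⟩
    rintro ⟨i₀, -, hi₀⟩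
    obtain ⟨i, hi, hii⟩ := hR.exists_gt i₀
    refine (hD ⟨i, hi⟩).image (f := fun a => ((g a).2, e a))
      (fun a _ b _ hab => he (Prod.mk.inj hab).2) ((hi₀ i hii.le).subset ?_)
    rintro _ ⟨a, ⟨haD, rfl⟩, rfl⟩
    exact ⟨a, haD, rfl⟩
  have hR := not_infinite.mp hR
  by_cases hC : ∃ i, {j | ¬ ρ.EvAvoids F (g ⁻¹' {(i, j)})}.Infinite
  · obtain ⟨i, hi⟩ := hC
    obtain ⟨D, hD, hDK⟩ := exists_pseudoIntersection hFd hs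
      (C := fun j : {j | ¬ ρ.EvAvoids F (g ⁻¹' {(i, j)})} => g ⁻¹' {(i, j.1)}) fun j => j.2
    refine ⟨D, ?_, hDK⟩
    rintro ⟨i₀, h1, h2⟩
    have hfin : {p : ℕ × ℕ | (i, p.1, p.2) ∈ (fun a => ((g a).1, (g a).2, e a)) '' D} ∈
        fin2Sets := by
      by_cases hi0 : i < i₀
      · exact h1 i hi0
      · exact fin2Sets_finite _ (h2 i (not_lt.mp hi0))
    obtain ⟨j₀, hj₀⟩ := hfin
    obtain ⟨j, hj, hjj⟩ := hi.exists_gt j₀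
    refine (hD ⟨j, hj⟩).image he.injOn ((hj₀ j hjj.le).subset ?_)
    rintro _ ⟨a, ⟨haD, ha⟩, rfl⟩
    have ha : g a = (i, j) := ha
    exact ⟨a, haD, by simp [ha]⟩
  · simp only [not_exists, not_infinite] at hC
    exfalso
    -- A line that `F` does not avoid lies in a plane that `F` does not avoid, so this finite set
    -- holds all bad lines. Once they are discarded, `G` avoids every line, and every plane beyond
    -- the bound `i₀` of the bad planes.
    have hT := hR.biUnion fun i _ => (hC i).image fun j => (i, j)
    obtain ⟨G, hG, hGB, hGF⟩ := hr _ (ρ.diff_notMem_ideal (ρ.toFun_notMem_ideal hFd)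
      (ρ.biUnion_mem_ideal hT fun p _ => hg p)) sdiff_subset
    obtain ⟨i₀, hi₀⟩ := hR.bddAbove
    obtain ⟨i, hi, hne⟩ := hF G hG (fun p => by
      by_cases hp : ρ.EvAvoids F (g ⁻¹' {p})
      · exact hGF _ hp
      · refine .of_disjoint hG (disjoint_left.mpr fun a ha hap => (hGB ha).2 ?_)
        refine mem_biUnion (x := p) (mem_biUnion (x := p.1) ?_ ⟨p.2, hp, rfl⟩) hap
        exact fun h => hp (h.mono fun b hb => congrArg Prod.fst hb)) i₀
    exact hne (hGF _ (not_not.mp fun h => hi.not_ge (hi₀ h)))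

end Basic

end PartitionRegular

namespace PartitionRegular

/-! ### FinBW spaces and boring spaces. -/

section Spaces

variable {Ω : Type v} {Λ : Type w} {ρ : PartitionRegular Ω Λ}

/-- A positive set on which `f` is constant yields a convergent restriction. -/
theorem exists_convergesTo_of_fiber {X : Type*} [TopologicalSpace X] {f : Λ → X} {x : X}
    (h : f ⁻¹' {x} ∉ ρ.ideal) : ∃ F ∈ ρ.dom, ∃ x : X, ρ.ConvergesTo f F x := by
  simp only [ideal, mem_ofPred_eq, not_forall, not_not] at h
  obtain ⟨F, hF, hFA⟩ := h
  refine ⟨F, hF, x, fun U hU => ⟨∅, ?_⟩⟩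
  rintro _ ⟨a, ha, rfl⟩
  rw [show f a = x from hFA (ρ.toFun_diff_subset_self hF ∅ ha)]
  exact mem_of_mem_nhds hU

/-- Transport the sequence to `Λ` by a bijection. A set almost contained in every `ρ(F \ K)`,
enumerated increasingly, turns `ρ`-convergence into ordinary convergence. -/
theorem FinBW.seqCompactSpace [Countable Ω] [Countable Λ] [Infinite Λ] {X : Type*}
    [TopologicalSpace X] (h : ρ.FinBW X) : SeqCompactSpace X := by
  refine ⟨fun s _ => ?_⟩
  obtain ⟨e⟩ : Nonempty (Λ ≃ ℕ) := nonempty_equiv_of_countable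
  obtain ⟨E, hE, x, hx⟩ := h (s ∘ e)
  obtain ⟨F, hF, hFE, hs⟩ := exists_isSparse hE
  obtain ⟨D, hD, hDK⟩ := exists_pseudoIntersection hF hs (C := fun _ : Unit => univ) fun _ ⟨K, hK⟩ =>
    ρ.infinite_toFun _ (ρ.diff_mem_dom F hF K) (by simp [disjoint_univ.mp hK])
  have hD : (e '' D).Infinite := by
    have := hD ()
    rw [inter_univ] at this
    exact this.image e.injective.injOn
  refine ⟨x, mem_univ x, Nat.nth (· ∈ e '' D), Nat.nth_strictMono hD, ?_⟩
  intro U hU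
  obtain ⟨K, hK⟩ := hx U hU
  have hsub := ρ.mono _ (ρ.diff_mem_dom F hF K) _ (ρ.diff_mem_dom E hE K)
    (sdiff_subset_sdiff_left hFE)
  have hfin := ((hDK K).image e).preimage (Nat.nth_injective hD).injOn
  rw [mem_map, ← Nat.cofinite_eq_atTop]
  refine hfin.subset fun n hn => ?_
  obtain ⟨a, ha, hae⟩ := Nat.nth_mem_of_infinite hD n
  refine ⟨a, ⟨ha, fun haK => hn ?_⟩, hae⟩
  have := hK (mem_image_of_mem _ (hsub haK))
  rwa [Function.comp_apply, hae] at this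

/-- In a boring Hausdorff space every countable set splits into a finite set and finitely many sets
each of which converges to a point. -/
theorem _root_.BoringSpace.exists_cover {X : Type*} [TopologicalSpace X] [T2Space X]
    (h : BoringSpace X) : ∃ (T : Set X) (U : X → Set X), T.Finite ∧
      (univ \ ⋃ x ∈ T, U x).Finite ∧ ∀ x ∈ T, ∀ V ∈ 𝓝 x, (U x \ V).Finite := by
  obtain ⟨hc, T, hT, hlim⟩ := h
  -- A convergent one-to-one sequence in `S` has its limit in `T`. With disjoint neighbourhoods of
  -- the points of `T`, an infinite subset of `U x` can then accumulate only at `x` among the points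
  -- of `T`.
  have key : ∀ S : Set X, S.Infinite → ∃ x ∈ T, ∀ V ∈ 𝓝 x, (S ∩ V).Nonempty := by
    intro S hS
    obtain ⟨x, φ, hφ, hx⟩ := SeqCompactSpace.tendsto_subseq fun n => (hS.natEmbedding S n : X)
    obtain ⟨y, hy, hy'⟩ := hlim _ ((Subtype.val_injective.comp
      (hS.natEmbedding S).injective).comp hφ.injective) ⟨x, hx⟩
    refine ⟨y, hy, fun V hV => ?_⟩
    obtain ⟨n, hn⟩ := (hy'.eventually hV).exists
    exact ⟨_, (hS.natEmbedding S (φ n)).2, hn⟩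
  obtain ⟨U, hU, hd⟩ := hT.t2_separation
  refine ⟨T, U, hT, ?_, fun x hx V hV => ?_⟩
  · by_contra hinf
    obtain ⟨x, hx, hV⟩ := key _ hinf
    obtain ⟨y, hy, hyU⟩ := hV _ ((hU x).2.mem_nhds (hU x).1)
    exact hy.2 (mem_biUnion hx hyU)
  · by_contra hinf
    obtain ⟨y, hy, hW⟩ := key _ hinf
    by_cases hxy : y = x
    · subst hxy
      obtain ⟨z, hz, hzV⟩ := hW V hV
      exact hz.2 hzV
    · obtain ⟨z, hz, hzU⟩ := hW _ ((hU y).2.mem_nhds (hU y).1)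
      exact disjoint_left.mp (hd hy hx hxy) hzU hz.1

/-- When all fibres of `f` are null, P₁⁻ gives a set avoiding each of them. Some piece `U x` of the
cover has positive preimage; below it, a neighbourhood of `x` misses only finitely many values, and
their fibres are avoided. -/
theorem S2.finBW_of_boringSpace [Countable Λ] (hρ : ρ.S2) (hP : ρ.P1Minus) {X : Type*}
    [TopologicalSpace X] [T2Space X] (hX : BoringSpace X) : ρ.FinBW X := by
  intro f
  by_cases hf : ∀ x, f ⁻¹' {x} ∈ ρ.ideal
  swap
  · obtain ⟨x, hx⟩ := not_forall.mp hf
    exact exists_convergesTo_of_fiber hx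
  obtain ⟨c, hc⟩ := (countable_range f).exists_injective_nat'
  obtain ⟨E, hE, hav⟩ := p1Minus_iff.mp hP (fun a => c ⟨f a, a, rfl⟩) fun n => by
    by_cases hn : ∃ a, c ⟨f a, a, rfl⟩ = n
    · obtain ⟨b, rfl⟩ := hn
      exact ρ.ideal_mono (fun a ha => congrArg Subtype.val (hc ha)) (hf (f b))
    · exact ρ.ideal_mono (fun a ha => (hn ⟨a, ha⟩).elim) ρ.empty_mem_ideal
  have hav : ∀ x, ρ.EvAvoids E (f ⁻¹' {x}) := by
    intro x
    by_cases hx : x ∈ range f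
    · obtain ⟨b, rfl⟩ := hx
      refine (hav (c ⟨f b, b, rfl⟩)).mono fun a ha => ?_
      have ha : f a = f b := ha
      simp [ha]
    · exact .of_disjoint hE (disjoint_left.mpr fun a _ ha => hx ⟨a, ha⟩)
  obtain ⟨F, hF, hFE, -, hr⟩ := hρ.exists_isRefinable hE
  obtain ⟨T, U, hT, hfin, hU⟩ := hX.exists_cover
  have hfib : ∀ S : Set X, S.Finite → f ⁻¹' S ∈ ρ.ideal := fun S hS => by
    rw [← biUnion_of_singleton S, preimage_iUnion₂]
    exact ρ.biUnion_mem_ideal hS fun x _ => hf x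
  have hpos : ∃ x ∈ T, ρ.toFun F ∩ f ⁻¹' U x ∉ ρ.ideal := by
    by_contra! hne
    refine ρ.toFun_notMem_ideal hF (ρ.ideal_mono ?_
      (ρ.union_mem_ideal (ρ.biUnion_mem_ideal hT hne) (hfib _ hfin)))
    intro a ha
    by_cases h : f a ∈ ⋃ x ∈ T, U x
    · obtain ⟨x, hx, hxU⟩ := mem_iUnion₂.mp h
      exact .inl (mem_biUnion hx ⟨ha, hxU⟩)
    · exact .inr ⟨mem_univ _, h⟩
  obtain ⟨x, hx, hpos⟩ := hpos
  obtain ⟨G, hG, hGB, hGF⟩ := hr _ hpos inter_subset_left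
  refine ⟨G, hG, x, convergesTo_iff.mpr fun V hV => ?_⟩
  have h1 : ρ.EvAvoids G (⋃ y ∈ U x \ V, f ⁻¹' {y}) := EvAvoids.biUnion hG (hU x hx V hV)
    fun y _ => hGF _ ((hav y).of_subset hF hE hFE)
  have h2 : ρ.EvAvoids G (f ⁻¹' (U x)ᶜ) :=
    .of_disjoint hG (disjoint_left.mpr fun a ha hna => hna (hGB ha).2)
  refine (h1.union hG h2).mono fun a ha => ?_
  by_cases h : f a ∈ U x
  · exact .inl (mem_biUnion ⟨h, ha⟩ rfl)
  · exact .inr h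

/-- Infinitely many limits of one-to-one sequences yield jointly one-to-one sequences with distinct
limits. -/
theorem exists_disjoint_sequences {X : Type*} [TopologicalSpace X] [T2Space X]
    (h : {x : X | ∃ s : ℕ → X, s.Injective ∧ Tendsto s atTop (𝓝 x)}.Infinite) :
    ∃ (x : ℕ → X) (s : ℕ × ℕ → X), x.Injective ∧ s.Injective ∧
      ∀ i, Tendsto (fun j => s (i, j)) atTop (𝓝 (x i)) := by
  let x : ℕ → X := fun n => h.natEmbedding _ n
  have hx : x.Injective := Subtype.val_injective.comp (h.natEmbedding _).injective
  choose t ht htx using fun n => (h.natEmbedding _ n).2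
  -- Separating the two limits leaves only finitely many terms of `t i'` outside `U`, while a tail
  -- of `t i` lies in `V`. Cutting off initial segments therefore makes the sequences pairwise
  -- disjoint.
  have key : ∀ i i', i' ≠ i → ∀ᶠ m in atTop, t i m ∉ range (t i') := by
    intro i i' hne
    obtain ⟨U, V, hU, hV, hxU, hxV, hUV⟩ := t2_separation (hx.ne hne)
    have hfin : (range (t i') \ U).Finite := by
      have := (htx i').eventually (hU.mem_nhds hxU)
      rw [← Nat.cofinite_eq_atTop] at this
      refine (Set.Finite.image (t i') this).subset ?_
      rintro _ ⟨⟨n, rfl⟩, hn⟩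
      exact ⟨n, hn, rfl⟩
    have h1 := hfin.preimage (ht i).injOn
    rw [← Nat.cofinite_eq_atTop]
    have h2 := (htx i).eventually (hV.mem_nhds hxV)
    rw [← Nat.cofinite_eq_atTop] at h2
    filter_upwards [h1.compl_mem_cofinite, h2] with m hm hmV hmr
    exact hm ⟨hmr, fun hmU => disjoint_left.mp hUV hmU hmV⟩
  have key' : ∀ i, ∃ N, ∀ m ≥ N, ∀ i' < i, t i m ∉ range (t i') := fun i => by
    have : ∀ᶠ m in atTop, ∀ i' ∈ Iio i, t i m ∉ range (t i') :=
      (eventually_all_finite (finite_Iio i)).mpr fun i' hi' => key i i' (ne_of_lt hi')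
    exact eventually_atTop.mp this
  choose N hN using key'
  refine ⟨x, fun p => t p.1 (p.2 + N p.1), hx, ?_, fun i =>
    (htx i).comp (tendsto_add_atTop_nat (N i))⟩
  rintro ⟨i, j⟩ ⟨i', j'⟩ hp
  simp only at hp
  rcases lt_trichotomy i i' with hlt | rfl | hlt
  · exact (hN i' _ (Nat.le_add_left _ j') i hlt ⟨_, hp⟩).elim
  · have := ht i hp
    simpa using this
  · exact (hN i _ (Nat.le_add_left _ j) i' hlt ⟨_, hp.symm⟩).elim

/-- If the set of limits were infinite, compose a labelling `g` with an injective array `s` of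
sequences having distinct limits. Let `y` be a limit given by FinBW. The fibre over `y` is null and
can be discarded, after which punctured neighbourhoods of `y` capture `G`. At most one row converges
to `y`, and its index serves as `i₀` in P₂⁻. -/
theorem S2.boringSpace_of_finBW [Countable Ω] [Countable Λ] [Infinite Λ] (hρ : ρ.S2)
    (hP : ¬ ρ.P2Minus) {X : Type*} [TopologicalSpace X] [T2Space X] (hX : ρ.FinBW X) :
    BoringSpace X := by
  refine ⟨hX.seqCompactSpace, {x : X | ∃ s : ℕ → X, s.Injective ∧ Tendsto s atTop (𝓝 x)}, ?_,
    fun s hs ⟨x, hx⟩ => ⟨x, ⟨s, hs, hx⟩, hx⟩⟩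
  by_contra hinf
  obtain ⟨x, s, hx, hs, hlim⟩ := exists_disjoint_sequences hinf
  refine hP (p2Minus_iff.mpr fun g hg => ?_)
  obtain ⟨E, hE, y, hy⟩ := hX (s ∘ g)
  obtain ⟨F, hF, hFE, -, hr⟩ := hρ.exists_isRefinable hE
  have hfib : (s ∘ g) ⁻¹' {y} ∈ ρ.ideal := by
    by_cases h : ∃ p, s p = y
    · obtain ⟨p, rfl⟩ := h
      exact ρ.ideal_mono (fun a ha => hs ha) (hg p)
    · exact ρ.ideal_mono (fun a ha => (h ⟨_, ha⟩).elim) ρ.empty_mem_ideal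
  obtain ⟨G, hG, hGB, hGF⟩ := hr _ (ρ.diff_notMem_ideal (ρ.toFun_notMem_ideal hF) hfib)
    sdiff_subset
  have hGy : ρ.EvAvoids G ((s ∘ g) ⁻¹' {y}) :=
    .of_disjoint hG (disjoint_left.mpr fun a ha => (hGB ha).2)
  have hGU : ∀ U ∈ 𝓝 y, ρ.EvAvoids G ((s ∘ g) ⁻¹' (U \ {y})ᶜ) := fun U hU =>
    ((hGF _ ((convergesTo_iff.mp hy U hU).of_subset hF hE hFE)).union hG hGy).mono fun a ha => by
      by_cases h : s (g a) = y
      · exact .inr h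
      · exact .inl fun h' => ha ⟨h', h⟩
  refine ⟨G, hG, fun p => ?_, ?_⟩
  · by_cases hp : s p = y
    · exact hGy.mono fun a ha => show s (g a) = y by rw [show g a = p from ha, hp]
    · refine (hGU {s p}ᶜ (compl_singleton_mem_nhds (Ne.symm hp))).mono fun a ha h => h.1 ?_
      exact congrArg s ha
  · have key : ∀ i, x i ≠ y → ρ.EvAvoids G {a | (g a).1 = i} := by
      intro i hi
      obtain ⟨U, V, hU, hV, hyU, hxV, hUV⟩ := t2_separation hi.symm
      have h1 := (hlim i).eventually (hV.mem_nhds hxV)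
      rw [← Nat.cofinite_eq_atTop] at h1
      have hfin : Set.Finite {j | s (i, j) ∉ V} := h1
      -- Only finitely many terms of row `i` can lie in `U`; deleting those other than `y` keeps a
      -- neighbourhood of `y`.
      have hW : U \ ((fun j => s (i, j)) '' {j | s (i, j) ∉ V} \ {y}) ∈ 𝓝 y :=
        (hU.sdiff ((hfin.image _).subset sdiff_subset).isClosed).mem_nhds ⟨hyU, fun h => h.2 rfl⟩
      refine (hGU _ hW).mono fun a ha => ?_
      rintro ⟨⟨haU, hn⟩, hay⟩
      have hga : g a = (i, (g a).2) := Prod.ext ha rfl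
      refine hn ⟨⟨(g a).2, fun h => ?_, by simp only [← hga]; rfl⟩, hay⟩
      rw [← hga] at h
      exact disjoint_left.mp hUV haU h
    by_cases h : ∃ i, x i = y
    · obtain ⟨i, rfl⟩ := h
      exact ⟨i, fun i' hi' => key i' (hx.ne (ne_of_gt hi'))⟩
    · exact ⟨0, fun i _ => key i fun hi => h ⟨i, hi⟩⟩

end Spaces

end PartitionRegular

/-! ### Two test spaces: `ℕ∞` and the one-point compactification of `ℕ × ℕ∞`. -/

theorem BoringSpace.of_homeomorph {X Y : Type*} [TopologicalSpace X] [TopologicalSpace Y]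
    (e : X ≃ₜ Y) (h : BoringSpace X) : BoringSpace Y := by
  obtain ⟨hc, F, hF, hlim⟩ := h
  refine ⟨⟨fun s _ => ?_⟩, e '' F, hF.image e, fun s hs ⟨y, hy⟩ => ?_⟩
  · obtain ⟨x, φ, hφ, hx⟩ := SeqCompactSpace.tendsto_subseq fun n => e.symm (s n)
    refine ⟨e x, mem_univ _, φ, hφ, ?_⟩
    simpa [Function.comp_def] using (e.continuous.tendsto x).comp hx
  · obtain ⟨x, hx, hxs⟩ := hlim (e.symm ∘ s) (e.symm.injective.comp hs)
      ⟨_, (e.symm.continuous.tendsto y).comp hy⟩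
    refine ⟨e x, mem_image_of_mem e hx, ?_⟩
    simpa [Function.comp_def] using (e.continuous.tendsto x).comp hxs

theorem boringSpace_enat : BoringSpace ℕ∞ := by
  refine ⟨inferInstance, {⊤}, finite_singleton _, fun s hs _ => ⟨⊤, rfl, ?_⟩⟩
  rw [ENat.tendsto_nhds_top_iff_natCast_lt, ← Nat.cofinite_eq_atTop]
  intro n
  have : (Iic (n : ℕ∞)).Finite := by
    refine ((finite_Iic n).image ((↑) : ℕ → ℕ∞)).subset fun x hx => ?_
    lift x to ℕ using ne_top_of_le_ne_top (ENat.natCast_ne_top n) hx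
    exact ⟨x, by simpa using hx, rfl⟩
  filter_upwards [(this.preimage hs.injOn).compl_mem_cofinite] with m hm
  exact not_le.mp hm

/-- Each row is a one-to-one sequence converging to its own `(i, ⊤)`, so the finite set would have
to contain all of these points. -/
theorem not_boringSpace_onePoint : ¬ BoringSpace (OnePoint (ℕ × ℕ∞)) := by
  rintro ⟨-, F, hF, hlim⟩
  have hinj : Function.Injective fun i : ℕ => (((i, ⊤) : ℕ × ℕ∞) : OnePoint (ℕ × ℕ∞)) :=
    fun i i' h => (Prod.mk.inj (OnePoint.coe_injective h)).1
  refine infinite_range_of_injective hinj (hF.subset ?_)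
  rintro _ ⟨i, rfl⟩
  have ht : Tendsto (fun j : ℕ => (((i, (j : ℕ∞)) : ℕ × ℕ∞) : OnePoint (ℕ × ℕ∞))) atTop
      (𝓝 (((i, ⊤) : ℕ × ℕ∞) : OnePoint (ℕ × ℕ∞))) :=
    (OnePoint.continuous_coe.tendsto _).comp
      ((tendsto_const_nhds (x := i)).prodMk_nhds ENat.tendsto_natCast_nhds_top)
  obtain ⟨x, hx, hxs⟩ := hlim _ (fun j j' h => by
    simpa using (Prod.mk.inj (OnePoint.coe_injective h)).2) ⟨_, ht⟩
  rwa [← tendsto_nhds_unique ht hxs] at hx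

namespace PartitionRegular

/-! ### What FinBW of the test spaces says about `ρ`. -/

section TestSpaces

variable {Ω : Type v} {Λ : Type w} {ρ : PartitionRegular Ω Λ}

theorem FinBW.of_homeomorph {X Y : Type*} [TopologicalSpace X] [TopologicalSpace Y]
    (e : X ≃ₜ Y) (h : ρ.FinBW X) : ρ.FinBW Y := by
  intro f
  obtain ⟨F, hF, x, hx⟩ := h (e.symm ∘ f)
  refine ⟨F, hF, e x, fun U hU => (hx _ (e.continuous.continuousAt hU)).imp fun K hK => ?_⟩
  rintro _ ⟨a, ha, rfl⟩
  simpa using hK (mem_image_of_mem _ ha)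

/-- Convergence of the labels to `⊤` means that every fibre is avoided. A finite limit is isolated,
so its fibre would be positive. -/
theorem p1Minus_of_finBW_enat (h : ρ.FinBW ℕ∞) : ρ.P1Minus := by
  refine p1Minus_iff.mpr fun g hg => ?_
  obtain ⟨F, hF, x, hx⟩ := h fun a => (g a : ℕ∞)
  rw [convergesTo_iff] at hx
  refine ⟨F, hF, fun n => ?_⟩
  by_cases hxt : x = ⊤
  · subst hxt
    refine (hx (Ioi n) (Ioi_mem_nhds (ENat.natCast_lt_top n))).mono fun a ha => ?_
    have ha : g a = n := ha
    simp [ha]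
  · lift x to ℕ using hxt
    obtain ⟨K, hK⟩ := hx {(x : ℕ∞)} ((ENat.mem_nhds_natCast_iff x).mpr rfl)
    refine (hg x _ (ρ.diff_mem_dom F hF K) fun a ha => ?_).elim
    by_contra hne
    exact disjoint_left.mp hK ha fun h' => hne (by simpa using h')

/-- With null fibres, code the countable space into `ω²` by rows and apply P₂⁻. Either some row is
positive and gives convergence to its end `(i, ⊤)`, or all rows are null, every row can be avoided,
and the limit is `∞`. -/
theorem S2.finBW_onePoint (hρ : ρ.S2) (hP : ρ.P2Minus) :
    ρ.FinBW (OnePoint (ℕ × ℕ∞)) := by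
  intro f
  by_cases hf : ∀ x, f ⁻¹' {x} ∈ ρ.ideal
  swap
  · obtain ⟨x, hx⟩ := not_forall.mp hf
    exact exists_convergesTo_of_fiber hx
  let row : ℕ → Set (OnePoint (ℕ × ℕ∞)) := fun i => (fun y : ℕ∞ => ((i, y) : ℕ × ℕ∞)) '' univ
  -- Row 0 of the code is reserved for `∞`. By the shift, the strict bound `i > i₀` in P₂⁻ covers
  -- all rows `i ≥ i₀` of the space.
  obtain ⟨c, hc, hrow⟩ : ∃ c : OnePoint (ℕ × ℕ∞) → ℕ × ℕ, c.Injective ∧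
      ∀ i y, (c ((i, y) : ℕ × ℕ∞)).1 = i + 1 := by
    obtain ⟨d, hd⟩ := exists_injective_nat ℕ∞
    refine ⟨fun x => x.elim (0, 0) fun p => (p.1 + 1, d p.2), fun x y h => ?_, fun i y => rfl⟩
    induction x using OnePoint.rec with
    | infty =>
      induction y using OnePoint.rec with
      | infty => rfl
      | coe q => simp at h
    | coe p =>
      induction y using OnePoint.rec with
      | infty => simp at h
      | coe q =>
        simp only [OnePoint.elim_some, Prod.mk.injEq, Nat.add_right_cancel_iff] at h
        exact congrArg _ (Prod.ext h.1 (hd h.2))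
  obtain ⟨E, hE, hav, i₀, hi₀⟩ := p2Minus_iff.mp hP (c ∘ f) fun p => by
    by_cases h : ∃ x, c x = p
    · obtain ⟨x, rfl⟩ := h
      exact ρ.ideal_mono (fun a ha => hc ha) (hf x)
    · exact ρ.ideal_mono (fun a ha => (h ⟨_, ha⟩).elim) ρ.empty_mem_ideal
  have hav : ∀ x, ρ.EvAvoids E (f ⁻¹' {x}) := fun x =>
    (hav (c x)).mono fun a ha => congrArg c ha
  have hi₀ : ∀ i ≥ i₀, ρ.EvAvoids E (f ⁻¹' row i) := fun i hi =>
    (hi₀ (i + 1) (Nat.lt_succ_of_le hi)).mono fun a ⟨y, _, hy⟩ => by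
      simp only [mem_ofPred_eq, Function.comp_apply, ← hy, hrow]
  obtain ⟨F, hF, hFE, -, hr⟩ := hρ.exists_isRefinable hE
  by_cases hpos : ∃ i, ρ.toFun F ∩ f ⁻¹' row i ∉ ρ.ideal
  · obtain ⟨i, hi⟩ := hpos
    obtain ⟨G, hG, hGB, hGF⟩ := hr _ hi inter_subset_left
    refine ⟨G, hG, ((i, ⊤) : ℕ × ℕ∞), convergesTo_iff.mpr fun V hV => ?_⟩
    have hVy : {y : ℕ∞ | (((i, y) : ℕ × ℕ∞) : OnePoint (ℕ × ℕ∞)) ∈ V} ∈ 𝓝 (⊤ : ℕ∞) :=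
      (OnePoint.continuous_coe.comp (Continuous.prodMk_right i)).continuousAt hV
    have hfin : {y : ℕ∞ | (((i, y) : ℕ × ℕ∞) : OnePoint (ℕ × ℕ∞)) ∉ V}.Finite := by
      have hev := ENat.tendsto_natCast_nhds_top.eventually hVy
      rw [← Nat.cofinite_eq_atTop] at hev
      refine (Set.Finite.image ((↑) : ℕ → ℕ∞) hev).subset fun y hy => ?_
      lift y to ℕ using (by rintro rfl; exact hy (mem_of_mem_nhds hV))
      exact ⟨y, hy, rfl⟩
    have h1 : ρ.EvAvoids G (⋃ y ∈ {y : ℕ∞ | (((i, y) : ℕ × ℕ∞) : OnePoint (ℕ × ℕ∞)) ∉ V},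
        f ⁻¹' {(((i, y) : ℕ × ℕ∞) : OnePoint (ℕ × ℕ∞))}) :=
      EvAvoids.biUnion hG hfin fun y _ => hGF _ ((hav _).of_subset hF hE hFE)
    have h2 : ρ.EvAvoids G (f ⁻¹' (row i)ᶜ) :=
      .of_disjoint hG (disjoint_left.mpr fun a ha hna => hna (hGB ha).2)
    refine (h1.union hG h2).mono fun a ha => ?_
    by_cases h : f a ∈ row i
    · obtain ⟨y, -, hy⟩ := h
      have hyV : (((i, y) : ℕ × ℕ∞) : OnePoint (ℕ × ℕ∞)) ∉ V := fun h => ha (hy ▸ h)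
      exact .inl (mem_biUnion (x := y) hyV hy.symm)
    · exact .inr h
  · push Not at hpos
    obtain ⟨G, hG, hGB, hGF⟩ := hr _ (ρ.diff_notMem_ideal (ρ.toFun_notMem_ideal hF)
      (ρ.biUnion_mem_ideal (finite_Iio i₀) fun i _ => hpos i)) sdiff_subset
    refine ⟨G, hG, OnePoint.infty, convergesTo_iff.mpr fun V hV => ?_⟩
    obtain ⟨C, ⟨-, hC⟩, hCV⟩ := OnePoint.hasBasis_nhds_infty.mem_iff.mp hV
    -- The complement of a neighbourhood of `∞` lies in a compact set, which meets only finitely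
    -- many rows.
    have hfin : (Prod.fst '' C).Finite := (hC.image continuous_fst).finite_of_discrete
    have h1 : ρ.EvAvoids G (⋃ i ∈ Prod.fst '' C, f ⁻¹' row i) :=
      EvAvoids.biUnion hG hfin fun i _ => by
        by_cases hi : i < i₀
        · exact .of_disjoint hG (disjoint_left.mpr fun a ha hai =>
            (hGB ha).2 (mem_biUnion (x := i) hi ⟨(hGB ha).1, hai⟩))
        · exact hGF _ ((hi₀ i (not_lt.mp hi)).of_subset hF hE hFE)
    refine h1.mono fun a ha => ?_
    have haC := mt (@hCV (f a)) ha
    obtain ⟨p, hp⟩ := OnePoint.ne_infty_iff_exists.mp fun h : f a = OnePoint.infty =>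
      haC (.inr h)
    have hpC : p ∈ C := by
      by_contra hpC
      exact haC (.inl ⟨p, hpC, hp⟩)
    exact mem_biUnion (mem_image_of_mem Prod.fst hpC) ⟨p.2, mem_univ _, hp⟩

end TestSpaces

end PartitionRegular

theorem mainTheorem2 {Ω : Type v} {Λ : Type w} [Countable Ω] [Infinite Ω] [Countable Λ]
    [Infinite Λ] (ρ : PartitionRegular Ω Λ) (hρ : ρ.S2) :
    List.TFAE [
      PartitionRegular.KatetovLE idealBI.rho ρ ∧ ¬ PartitionRegular.KatetovLE idealFIN2.rho ρ,
      ρ.P1Minus ∧ ¬ ρ.P2Minus,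
      ∀ (X : Type u) [TopologicalSpace X] [T2Space X], ρ.FinBW X ↔ BoringSpace X] := by
  tfae_have 1 ↔ 2 := by
    refine ⟨fun ⟨hB, hF⟩ => ⟨?_, PartitionRegular.not_p2Minus_of_katetovLE hB⟩,
      fun ⟨h1, h2⟩ => ⟨hρ.katetovLE_BI h2, fun h => PartitionRegular.not_p1Minus_of_katetovLE h h1⟩⟩
    by_contra h
    exact hF (hρ.katetovLE_FIN2 h)
  tfae_have 2 → 3 := fun ⟨h1, h2⟩ X _ _ =>
    ⟨hρ.boringSpace_of_finBW h2, hρ.finBW_of_boringSpace h1⟩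
  tfae_have 3 → 2 := by
    -- Condition 3 speaks of spaces in universe `u`, so the test spaces are lifted there by `ULift`.
    refine fun h => ⟨?_, fun h2 => ?_⟩
    · exact PartitionRegular.p1Minus_of_finBW_enat (PartitionRegular.FinBW.of_homeomorph
        Homeomorph.ulift ((h (ULift.{u} ℕ∞)).mpr
          (boringSpace_enat.of_homeomorph Homeomorph.ulift.symm)))
    · exact not_boringSpace_onePoint (((h (ULift.{u} (OnePoint (ℕ × ℕ∞)))).mp
        ((hρ.finBW_onePoint h2).of_homeomorph Homeomorph.ulift.symm)).of_homeomorph Homeomorph.ulift)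
  tfae_finish
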